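/- Let $T=\{z\in\mathbb C:|z|=1\}$ and let $G$ be a second countable locally compact Hausdorff abelian group, written additively, which is $2$-regular, i.e. $x\mapsto 2x$ is a bijection of $G$. Let $m:G\times G\to T$ be a symplectic bicharacter: $m$ is continuous, is a character in each argument, satisfies $m(x,y)m(y,x)=1$ and $m(x,x)=1$ for all $x,y\in G$, and $y\mapsto m(\cdot,y)$ is an isomorphism of topological groups from $G$ onto its dual $\widehat G$. Let $L\subset G$ be a compact subgroup which is maximal isotropic for $m$ (maximal among the subgroups on which $m$ is identically $1$). Let $W$ be an $m$-representation of $G$ on a complex Hilbert space $\mathcal H$, not necessarily irreducible: a Borel map from $G$ into the unitary group of $\mathcal H$ with $W(0)=1$ and $W(x)W(y)=m(x,y)W(x+y)$ for all $x,y\in G$. Put $\mathcal H^L=\{\psi\in\mathcal H: W(a)\psi=\psi\ \text{for all } a\in L\}$ and $L/2=\{x\in G:2x\in L\}$. The operators $W(x)$, $x\in L/2$, map $\mathcal H^L$ onto itself, and $W^L$ denotes the resulting $m$-representation of $L/2$ on $\mathcal H^L$. A closed invariant subspace is called irreducible if it is nonzero and contains no closed invariant subspaces other than $0$ and itself. Then: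 1. $\mathcal H^L$ is an orthogonal (Hilbert space) direct sum of closed subspaces $\mathcal K_i$ which are irreducible under $W^L$. 2. $W$ is irreducible on $\mathcal H$ if and only if $\mathcal H^L$ is irreducible under $W^L$. 3. In particular, if $W$ is irreducible, then $\dim\mathcal H^L<\infty$. -/

import Mathlib

open MeasureTheory

noncomputable section

/-- A bicharacter of a topological abelian group `G`: a continuous map `G × G → T` into the circle
which is a character in each argument. -/
structure Bicharacter (G : Type*) [AddCommGroup G] [TopologicalSpace G] where
  toFun : G → G → Circle
  map_add_left : ∀ x y z, toFun (x + y) z = toFun x z * toFun y z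
  map_add_right : ∀ x y z, toFun x (y + z) = toFun x y * toFun x z
  continuous_toFun : Continuous fun p : G × G => toFun p.1 p.2

namespace Bicharacter

variable {G : Type*} [AddCommGroup G] [TopologicalSpace G]

instance : CoeFun (Bicharacter G) (fun _ => G → G → Circle) := ⟨toFun⟩

theorem map_zero_left (b : Bicharacter G) (y : G) : b 0 y = 1 := by
  have h := b.map_add_left 0 0 y
  rw [add_zero] at h
  exact (mul_eq_left.mp h.symm)

/-- The map `β_b : G → Ĝ`, `(x, β_b y) = b x y`. -/
def toDual (b : Bicharacter G) (y : G) : PontryaginDual (Multiplicative G) where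
  toFun x := b x.toAdd y
  map_one' := b.map_zero_left y
  map_mul' x x' := b.map_add_left x.toAdd x'.toAdd y
  continuous_toFun :=
    b.continuous_toFun.comp ((continuous_toAdd).prodMk continuous_const)

/-- Alternating (antisymmetric) bicharacters. -/
structure IsAlternating (b : Bicharacter G) : Prop where
  mul_swap : ∀ x y, b x y * b y x = 1
  self : ∀ x, b x x = 1

/-- Symplectic bicharacters: alternating, and `β_b` (which is always a homomorphism) is an
isomorphism of topological groups from `G` onto its dual. -/
structure IsSymplectic (b : Bicharacter G) : Prop where
  alternating : b.IsAlternating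
  isHomeomorph_toDual : IsHomeomorph b.toDual

/-- A subgroup `L` is isotropic for `b` if `b` is identically `1` on `L × L`. -/
def IsIsotropic (b : Bicharacter G) (L : AddSubgroup G) : Prop :=
  ∀ x ∈ L, ∀ y ∈ L, b x y = 1

/-- Maximal elements, with respect to inclusion, among the isotropic subgroups. -/
def IsMaximalIsotropic (b : Bicharacter G) (L : AddSubgroup G) : Prop :=
  Maximal b.IsIsotropic L

end Bicharacter

/-- `G` is 2-regular if `x ↦ 2x` is a bijection of `G`. -/
def IsTwoRegular (G : Type*) [AddCommGroup G] : Prop :=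
  Function.Bijective fun x : G => 2 • x

/-- `L/2`: the inverse image of `L` under `x ↦ 2x`. -/
def halfSubgroup {G : Type*} [AddCommGroup G] (L : AddSubgroup G) : AddSubgroup G :=
  L.comap (nsmulAddMonoidHom 2)

theorem mem_halfSubgroup {G : Type*} [AddCommGroup G] {L : AddSubgroup G} {x : G} :
    x ∈ halfSubgroup L ↔ 2 • x ∈ L := Iff.rfl

/-- A (unitary, projective) `m`-representation of `G` on `H`: a Borel map `U` from `G` to the
unitary group of `H` with `U x ∘ U y = m x y • U (x + y)` and `U 0 = 1`.

The Borel condition is that every orbit map `x ↦ U x ψ` is Borel with separable range. If `H` is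
separable this is the usual Borel measurability for the strong (equivalently, weak) operator
topology. It is also the same thing for arbitrary `H` when `G` is Polish, because a Borel map from
a Polish space to a metric space has separable range. -/
structure MRep {G : Type*} [AddCommGroup G] [MeasurableSpace G] (m : G → G → Circle)
    (H : Type*) [NormedAddCommGroup H] [InnerProductSpace ℂ H] where
  toFun : G → (H ≃ₗᵢ[ℂ] H)
  map_zero : ∀ ψ, toFun 0 ψ = ψ
  map_mul : ∀ x y ψ, toFun x (toFun y ψ) = (m x y : ℂ) • toFun (x + y) ψ
  borel : ∀ ψ, StronglyMeasurable fun x => toFun x ψ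

namespace MRep

variable {G : Type*} [AddCommGroup G] [MeasurableSpace G]
  {H : Type*} [NormedAddCommGroup H] [InnerProductSpace ℂ H]

instance {m : G → G → Circle} : CoeFun (MRep m H) (fun _ => G → (H ≃ₗᵢ[ℂ] H)) := ⟨toFun⟩

/-- `K` is stable under all operators `W x`. -/
def IsInvariant {m : G → G → Circle} (W : MRep m H) (K : Submodule ℂ H) : Prop :=
  ∀ x, ∀ ψ ∈ K, W x ψ ∈ K

/-- The subspace `K` is irreducible under `W`: it is a nonzero closed invariant subspace, and its
only closed invariant subspaces are `0` and `K`. -/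
structure IsIrreducibleOn {m : G → G → Circle} (W : MRep m H) (K : Submodule ℂ H) : Prop where
  isClosed : IsClosed (K : Set H)
  invariant : W.IsInvariant K
  ne_bot : K ≠ ⊥
  eq_bot_or_eq : ∀ N : Submodule ℂ H, N ≤ K → IsClosed (N : Set H) → W.IsInvariant N →
    N = ⊥ ∨ N = K

/-- `W` is irreducible (on the whole space `H`). -/
def IsIrreducible {m : G → G → Circle} (W : MRep m H) : Prop :=
  W.IsIrreducibleOn ⊤

/-- The vacuum space `H^L`: the vectors fixed by all `W a`, `a ∈ L`. -/
def vacuum {m : G → G → Circle} (W : MRep m H) (L : AddSubgroup G) : Submodule ℂ H where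
  carrier := {ψ | ∀ a ∈ L, W a ψ = ψ}
  add_mem' hφ hψ a ha := by rw [map_add, hφ a ha, hψ a ha]
  zero_mem' a _ := _root_.map_zero _
  smul_mem' c ψ hψ a ha := by rw [_root_.map_smul, hψ a ha]

theorem isClosed_vacuum {m : G → G → Circle} (W : MRep m H) (L : AddSubgroup G) :
    IsClosed (W.vacuum L : Set H) := by
  have : (W.vacuum L : Set H) = ⋂ a ∈ L, {ψ | W a ψ = ψ} := by
    ext ψ
    simp [vacuum]
  rw [this]
  exact isClosed_biInter fun a _ => isClosed_eq (W a).continuous continuous_id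

instance {m : G → G → Circle} [CompleteSpace H] (W : MRep m H) (L : AddSubgroup G) :
    CompleteSpace (W.vacuum L) :=
  (W.isClosed_vacuum L).completeSpace_coe

section VacuumRep

variable [TopologicalSpace G] {m : Bicharacter G}

/-- If `2x ∈ L` then `W x` commutes with `W a` for every `a ∈ L`. -/
theorem comm_of_mem_half (W : MRep m H) (hm : m.IsAlternating) {L : AddSubgroup G}
    (hL : m.IsIsotropic L) {x : G} (hx : x ∈ halfSubgroup L) {a : G} (ha : a ∈ L) (ψ : H) :
    W a (W x ψ) = W x (W a ψ) := by
  have h1 : m a x * m a x = 1 := by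
    rw [← m.map_add_right, ← two_nsmul]
    exact hL a ha _ hx
  have h2 : m a x = m x a :=
    (eq_inv_of_mul_eq_one_left h1).trans (eq_inv_of_mul_eq_one_right (hm.mul_swap a x)).symm
  rw [W.map_mul, W.map_mul, h2, add_comm]

theorem apply_mem_vacuum (W : MRep m H) (hm : m.IsAlternating) {L : AddSubgroup G}
    (hL : m.IsIsotropic L) {x : G} (hx : x ∈ halfSubgroup L) {ψ : H} (hψ : ψ ∈ W.vacuum L) :
    W x ψ ∈ W.vacuum L := by
  intro a ha
  rw [W.comm_of_mem_half hm hL hx ha, hψ a ha]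

theorem symm_apply_mem_vacuum (W : MRep m H) (hm : m.IsAlternating) {L : AddSubgroup G}
    (hL : m.IsIsotropic L) {x : G} (hx : x ∈ halfSubgroup L) {ψ : H} (hψ : ψ ∈ W.vacuum L) :
    (W x).symm ψ ∈ W.vacuum L := by
  intro a ha
  apply (W x).injective
  rw [← W.comm_of_mem_half hm hL hx ha, (W x).apply_symm_apply, hψ a ha]

/-- `W^L`: the `m`-representation of `L/2` on `H^L` given by restricting `W`. -/
def vacuumRep (W : MRep m H) (hm : m.IsAlternating) {L : AddSubgroup G}
    (hL : m.IsIsotropic L) :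
    MRep (fun x y : halfSubgroup L => m x y) (W.vacuum L) where
  toFun x :=
    { toFun := fun ψ => ⟨W x ψ, W.apply_mem_vacuum hm hL x.2 ψ.2⟩
      invFun := fun ψ => ⟨(W x).symm ψ, W.symm_apply_mem_vacuum hm hL x.2 ψ.2⟩
      left_inv := fun ψ => Subtype.ext ((W x).symm_apply_apply ψ)
      right_inv := fun ψ => Subtype.ext ((W x).apply_symm_apply ψ)
      map_add' := fun φ ψ => Subtype.ext (map_add (W x) (φ : H) ψ)
      map_smul' := fun c ψ => Subtype.ext (_root_.map_smul (W x) c (ψ : H))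
      norm_map' := fun ψ => (W x).norm_map ψ }
  map_zero ψ := Subtype.ext (W.map_zero ψ)
  map_mul x y ψ := Subtype.ext (W.map_mul x y ψ)
  borel ψ := by
    refine (Embedding.comp_stronglyMeasurable_iff Topology.IsEmbedding.subtypeVal).mp ?_
    exact (W.borel (ψ : H)).comp_measurable measurable_subtype_coe

end VacuumRep

end MRep

end

noncomputable section

/-! `L` contains its own annihilator and the circle has no small subgroups, so `L` is open. Doubling
is a homeomorphism, so `L/2` is compact, hence covered by finitely many cosets of `L`. As `L` fixes
the vacuum vectors, each `W^L`-orbit spans a finite-dimensional space. Zorn's lemma then yields the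
Hilbert sum, and an irreducible `W^L` is finite-dimensional.

The equivalence rests on two facts. Every nonzero closed `W`-invariant subspace contains a nonzero
vacuum vector (`IsInvariant.inf_vacuum_ne_bot`): the Fourier coefficients of `a ↦ W a ψ` over `L`
are `L`-eigenvectors, some `W y` carries each into the vacuum space, and by Stone–Weierstrass they
cannot all vanish if `ψ ≠ 0`. And `W x` with `x ∉ L/2` sends `H^L` into its orthogonal complement
(`inner_apply_eq_zero`), so only `L/2` matters for orbits seen from within `H^L`. -/

theorem continuous_circle_coe : Continuous fun z : Circle => (z : ℂ) := by fun_prop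

/-! ### Annihilators, characters on `L`, and openness of `L` -/

namespace Bicharacter

variable {G : Type*} [AddCommGroup G] [TopologicalSpace G]

theorem map_zero_right (b : Bicharacter G) (x : G) : b x 0 = 1 := by
  have h := b.map_add_right x 0 0
  rw [add_zero] at h
  exact mul_eq_left.mp h.symm

theorem map_neg_left (b : Bicharacter G) (x y : G) : b (-x) y = (b x y)⁻¹ := by
  rw [eq_inv_iff_mul_eq_one, ← b.map_add_left, neg_add_cancel, b.map_zero_left]

theorem map_neg_right (b : Bicharacter G) (x y : G) : b x (-y) = (b x y)⁻¹ := by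
  rw [eq_inv_iff_mul_eq_one, ← b.map_add_right, neg_add_cancel, b.map_zero_right]

theorem IsAlternating.swap {b : Bicharacter G} (hb : b.IsAlternating) (x y : G) :
    b y x = (b x y)⁻¹ :=
  eq_inv_of_mul_eq_one_right (hb.mul_swap x y)

theorem IsSymplectic.separating {b : Bicharacter G} (hb : b.IsSymplectic) {x y : G}
    (h : ∀ z, b z x = b z y) : x = y :=
  hb.isHomeomorph_toDual.injective (PontryaginDual.ext fun z => h z.toAdd)

/-- A maximal isotropic subgroup contains its own annihilator. -/
theorem IsMaximalIsotropic.mem_of_forall_eq_one {b : Bicharacter G} (hb : b.IsAlternating)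
    {L : AddSubgroup G} (hL : b.IsMaximalIsotropic L) {x : G} (hx : ∀ a ∈ L, b a x = 1) :
    x ∈ L := by
  have hiso : b.IsIsotropic (AddSubgroup.closure (insert x (L : Set G))) := by
    intro y hy z hz
    induction hy, hz using AddSubgroup.closure_induction₂ with
    | mem y z hy hz =>
      rcases hy with rfl | hy <;> rcases hz with rfl | hz
      · exact hb.self _
      · rw [hb.swap z, hx z hz, inv_one]
      · exact hx y hy
      · exact hL.prop y hy z hz
    | zero_left y hy => exact b.map_zero_left y
    | zero_right y hy => exact b.map_zero_right y
    | add_left x y z _ _ _ h₁ h₂ => rw [b.map_add_left, h₁, h₂, mul_one]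
    | add_right x y z _ _ _ h₁ h₂ => rw [b.map_add_right, h₁, h₂, mul_one]
    | neg_left x y _ _ h => rw [b.map_neg_left, h, inv_one]
    | neg_right x y _ _ h => rw [b.map_neg_right, h, inv_one]
  have hle : L ≤ AddSubgroup.closure (insert x (L : Set G)) := fun a ha =>
    AddSubgroup.subset_closure (Set.mem_insert_of_mem x ha)
  exact hL.le_of_ge hiso hle (AddSubgroup.subset_closure (Set.mem_insert x _))

/-- The restriction to a subgroup of the character `b z ·`. -/
def restrictChar (b : Bicharacter G) (L : AddSubgroup G) (z : G) : C(L, ℂ) where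
  toFun a := b z a
  continuous_toFun := continuous_circle_coe.comp
    (b.continuous_toFun.comp (continuous_const.prodMk continuous_subtype_val))

theorem restrictChar_apply (b : Bicharacter G) (L : AddSubgroup G) (z : G) (a : L) :
    b.restrictChar L z a = (b z a : ℂ) := rfl

/-- The star subalgebra of `C(L, ℂ)` generated by the characters `b z ·`. -/
def charSubalgebra (b : Bicharacter G) (L : AddSubgroup G) : StarSubalgebra ℂ C(L, ℂ) where
  toSubalgebra := Algebra.adjoin ℂ (Set.range (b.restrictChar L))
  star_mem' := by
    change Algebra.adjoin ℂ (Set.range (b.restrictChar L)) ≤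
      star (Algebra.adjoin ℂ (Set.range (b.restrictChar L)))
    refine Algebra.adjoin_le ?_
    rintro - ⟨z, rfl⟩
    refine Algebra.subset_adjoin ⟨-z, ContinuousMap.ext fun a => ?_⟩
    rw [restrictChar_apply, b.map_neg_left, Circle.coe_inv_eq_conj]
    rfl

/-- The characters are closed under multiplication, so adjoining them creates nothing beyond linear
combinations. -/
theorem charSubalgebra_toSubmodule (b : Bicharacter G) (L : AddSubgroup G) :
    Subalgebra.toSubmodule (b.charSubalgebra L).toSubalgebra =
      Submodule.span ℂ (Set.range (b.restrictChar L)) := by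
  apply Algebra.adjoin_eq_span_of_subset
  refine Set.Subset.trans ?_ Submodule.subset_span
  intro x hx
  refine Submonoid.closure_induction (fun _ => id) ⟨0, ?_⟩ ?_ hx
  · ext a
    simp [restrictChar_apply, b.map_zero_left]
  · rintro - - - - ⟨x, rfl⟩ ⟨y, rfl⟩
    refine ⟨x + y, ?_⟩
    ext a
    simp [restrictChar_apply, b.map_add_left]

/-- On a compact subgroup the characters `b z ·` span a dense space of continuous functions. -/
theorem IsSymplectic.dense_span_restrictChar {b : Bicharacter G} (hb : b.IsSymplectic)
    (L : AddSubgroup G) [CompactSpace L] :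
    Dense (Submodule.span ℂ (Set.range (b.restrictChar L)) : Set C(L, ℂ)) := by
  have hsep : (b.charSubalgebra L).SeparatesPoints := by
    intro x y hxy
    have : ∃ z, b z x ≠ b z y := by
      by_contra! h
      exact hxy (Subtype.ext (hb.separating h))
    obtain ⟨z, hz⟩ := this
    exact ⟨_, ⟨b.restrictChar L z, Algebra.subset_adjoin ⟨z, rfl⟩, rfl⟩,
      fun h => hz (Circle.ext h)⟩
  rw [Submodule.dense_iff_topologicalClosure_eq_top, ← charSubalgebra_toSubmodule]
  exact congr_arg (Subalgebra.toSubmodule <| StarSubalgebra.toSubalgebra ·)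
    (ContinuousMap.starSubalgebra_topologicalClosure_eq_top_of_separatesPoints _ hsep)

/-- A compact maximal isotropic subgroup is open. -/
theorem IsMaximalIsotropic.isOpen_of_isCompact [IsTopologicalAddGroup G] {b : Bicharacter G}
    (hb : b.IsAlternating) {L : AddSubgroup G} (hL : b.IsMaximalIsotropic L)
    (hLc : IsCompact (L : Set G)) : IsOpen (L : Set G) := by
  refine AddSubgroup.isOpen_of_mem_nhds L (g := 0) ?_
  have hcont : Continuous fun p : G × G => ‖(b p.2 p.1 : ℂ) - 1‖ :=
    ((continuous_circle_coe.comp (b.continuous_toFun.comp continuous_swap)).sub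
      continuous_const).norm
  have hev : ∀ᶠ x in nhds (0 : G), ∀ a ∈ (L : Set G), ‖(b a x : ℂ) - 1‖ < 1 := by
    refine hLc.eventually_forall_of_forall_eventually fun a _ => ?_
    refine hcont.continuousAt.eventually_lt continuousAt_const ?_
    simp [b.map_zero_right]
  filter_upwards [hev] with x hx
  refine hL.mem_of_forall_eq_one hb ?_
  obtain ⟨a, ha, hmax⟩ := hLc.exists_isMaxOn ⟨0, L.zero_mem⟩
    (f := fun a => ‖(b a x : ℂ) - 1‖)
    (hcont.comp (continuous_const.prodMk continuous_id)).continuousOn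
  -- With `t = b a x` at the maximum, `a + a ∈ L` gives `|t² - 1| ≤ |t - 1|`. Since `|t - 1| < 1`
  -- forces `|t + 1| > 1`, it follows that `t = 1`.
  have hsq : ‖(b a x : ℂ) - 1‖ * ‖(b a x : ℂ) + 1‖ ≤ ‖(b a x : ℂ) - 1‖ := by
    have h := hmax (L.add_mem ha ha)
    simp only [b.map_add_left, Set.mem_ofPred_eq, Circle.coe_mul] at h
    rw [← norm_mul]
    rwa [show ((b a x : ℂ) - 1) * ((b a x : ℂ) + 1) = b a x * b a x - 1 by ring]
  have hlt : 1 < ‖(b a x : ℂ) + 1‖ := by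
    have h₁ : ‖(2 : ℂ)‖ ≤ ‖(b a x : ℂ) + 1‖ + ‖(b a x : ℂ) - 1‖ := by
      have h := norm_sub_le ((b a x : ℂ) + 1) ((b a x : ℂ) - 1)
      rwa [show (b a x : ℂ) + 1 - (b a x - 1) = 2 by ring] at h
    have h₂ := hx a ha
    rw [Complex.norm_ofNat] at h₁
    linarith
  have hzero : ‖(b a x : ℂ) - 1‖ = 0 := by
    by_contra h
    have hpos := lt_of_le_of_ne (norm_nonneg _) (Ne.symm h)
    nlinarith
  intro c hc
  have h : ‖(b c x : ℂ) - 1‖ ≤ 0 := (hmax hc).trans hzero.le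
  exact Circle.ext (sub_eq_zero.mp (norm_le_zero_iff.mp h))

end Bicharacter

/-! ### Compactness of `L/2` and a vanishing criterion for vector-valued functions -/

/-- In a 2-regular σ-compact locally compact group, `L/2` is compact if `L` is. -/
theorem isCompact_halfSubgroup {G : Type*} [AddCommGroup G] [TopologicalSpace G]
    [IsTopologicalAddGroup G] [T2Space G] [LocallyCompactSpace G] [SigmaCompactSpace G]
    (hG : IsTwoRegular G) {L : AddSubgroup G} (hLc : IsCompact (L : Set G)) :
    IsCompact (halfSubgroup L : Set G) := by
  have hcont : Continuous (nsmulAddMonoidHom 2 : G →+ G) := continuous_nsmul 2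
  have hopen : IsOpenMap (nsmulAddMonoidHom 2 : G →+ G) :=
    AddMonoidHom.isOpenMap_of_sigmaCompact _ hG.2 hcont
  exact (Equiv.toHomeomorphOfContinuousOpen (Equiv.ofBijective _ hG) hcont
    hopen).isCompact_preimage.mpr hLc

/-- A compact subgroup is a finite union of cosets of an open subgroup. -/
theorem AddSubgroup.exists_finset_sub_mem_of_isCompact {G : Type*} [AddCommGroup G]
    [TopologicalSpace G] [IsTopologicalAddGroup G] {L M : AddSubgroup G}
    (hL : IsOpen (L : Set G)) (hM : IsCompact (M : Set G)) :
    ∃ s : Finset G, (∀ y ∈ s, y ∈ M) ∧ ∀ x ∈ M, ∃ y ∈ s, x - y ∈ L := by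
  obtain ⟨s, hs, hcov⟩ := hM.elim_nhds_subcover (fun y => {x | x - y ∈ L}) fun y _ =>
    (hL.preimage (continuous_sub_right y)).mem_nhds (by simp)
  exact ⟨s, hs, fun x hx => by simpa using hcov hx⟩

/-- A bounded strongly measurable function on a compact space that integrates to zero against a
family of continuous functions with dense span vanishes almost everywhere. -/
theorem ae_eq_zero_of_integral_smul_eq_zero_of_dense {X : Type*} [TopologicalSpace X]
    [CompactSpace X] [T2Space X] [MeasurableSpace X] [BorelSpace X]
    [SecondCountableTopology X]
    {μ : Measure X} [IsFiniteMeasure μ] [μ.WeaklyRegular]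
    {E : Type*} [NormedAddCommGroup E] [NormedSpace ℂ E] [CompleteSpace E] {f : X → E}
    (hf : StronglyMeasurable f) {C : ℝ} (hC : ∀ x, ‖f x‖ ≤ C) {S : Set C(X, ℂ)}
    (hS : Dense (Submodule.span ℂ S : Set C(X, ℂ))) (h : ∀ g ∈ S, ∫ x, g x • f x ∂μ = 0) :
    f =ᵐ[μ] 0 := by
  refine ae_eq_zero_of_forall_dual_of_isSeparable ℂ hf.isSeparable_range (fun c => ?_)
    (.of_forall fun x => Set.mem_range_self x)
  have hmem : MemLp (fun x => star (c (f x))) 2 μ := by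
    refine MemLp.of_bound (C := ‖c‖ * C) ?_ (.of_forall fun x => ?_)
    · exact (continuous_star.comp_stronglyMeasurable
        (c.continuous.comp_stronglyMeasurable hf)).aestronglyMeasurable
    · rw [norm_star]
      exact (c.le_opNorm _).trans (mul_le_mul_of_nonneg_left (hC x) (norm_nonneg c))
  -- `T g` equals `c (∫ g • f)`, so `T` vanishes on `S` and hence everywhere; the conjugate of `c ∘
  -- f` is then orthogonal to a dense subspace of `L²`.
  let T : C(X, ℂ) →L[ℂ] ℂ := (innerSL ℂ hmem.toLp) ∘L (ContinuousMap.toLp 2 μ ℂ)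
  have hT : T = 0 := by
    refine ContinuousLinearMap.ext_on hS fun g hg => ?_
    have hint : Integrable (fun x => g x • f x) μ := by
      refine Integrable.of_bound (C := ‖g‖ * C)
        (g.continuous.stronglyMeasurable.smul hf).aestronglyMeasurable (.of_forall fun x => ?_)
      rw [norm_smul]
      exact mul_le_mul (g.norm_coe_le_norm x) (hC x) (norm_nonneg _) (norm_nonneg _)
    have hval : T g = ∫ x, c (g x • f x) ∂μ := by
      change inner ℂ hmem.toLp (ContinuousMap.toLp 2 μ ℂ g) = _
      rw [L2.inner_def]
      refine integral_congr_ae ?_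
      filter_upwards [hmem.coeFn_toLp, ContinuousMap.coeFn_toLp (p := 2) (𝕜 := ℂ) μ g]
        with x hx₁ hx₂
      rw [hx₁, hx₂]
      simp
    rw [hval, c.integral_comp_comm hint, h g hg, map_zero]
    rfl
  have hzero : hmem.toLp = 0 := by
    rw [← inner_self_eq_zero (𝕜 := ℂ)]
    refine (ContinuousMap.toLp_denseRange ℂ μ ℂ (p := 2) (by simp)).induction_on
      (p := fun v => inner ℂ hmem.toLp v = 0) _
      (isClosed_eq (by fun_prop) continuous_const) fun g => ?_
    exact DFunLike.congr_fun hT g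
  have := (Lp.eq_zero_iff_ae_eq_zero.mp hzero)
  filter_upwards [this, hmem.coeFn_toLp] with x hx₁ hx₂
  rw [hx₂] at hx₁
  simpa using hx₁

/-! ### Invariant subspaces and locally finite representations -/

namespace MRep

section Basic

variable {G : Type*} [AddCommGroup G] [MeasurableSpace G]
  {H : Type*} [NormedAddCommGroup H] [InnerProductSpace ℂ H] {m : G → G → Circle}

theorem apply_neg_apply (W : MRep m H) (x : G) (ψ : H) :
    W x (W (-x) ψ) = (m x (-x) : ℂ) • ψ := by
  rw [W.map_mul, add_neg_cancel, W.map_zero]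

/-- The inverse of `W x` is a scalar multiple of `W (-x)`. -/
theorem IsInvariant.symm_apply_mem {W : MRep m H} {K : Submodule ℂ H} (hK : W.IsInvariant K)
    (x : G) {ψ : H} (hψ : ψ ∈ K) : (W x).symm ψ ∈ K := by
  have h : (W x).symm ψ = (m x (-x) : ℂ)⁻¹ • W (-x) ψ := by
    apply (W x).injective
    rw [(W x).apply_symm_apply, _root_.map_smul, W.apply_neg_apply, smul_smul,
      inv_mul_cancel₀ (Circle.coe_ne_zero _), one_smul]
  rw [h]
  exact K.smul_mem _ (hK (-x) ψ hψ)

theorem IsInvariant.orthogonal {W : MRep m H} {K : Submodule ℂ H} (hK : W.IsInvariant K) :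
    W.IsInvariant Kᗮ := by
  intro x ψ hψ φ hφ
  rw [← (W x).apply_symm_apply φ, (W x).inner_map_map]
  exact hψ _ (hK.symm_apply_mem x hφ)

theorem isInvariant_sSup {W : MRep m H} {𝒦 : Set (Submodule ℂ H)}
    (h : ∀ K ∈ 𝒦, W.IsInvariant K) : W.IsInvariant (sSup 𝒦) := by
  intro x
  change sSup 𝒦 ≤ (sSup 𝒦).comap (W x).toLinearEquiv.toLinearMap
  exact sSup_le fun K hK ψ hψ => le_sSup hK (h K hK x ψ hψ)

/-- The span of the orbit of a set of vectors. -/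
def orbitSpan (W : MRep m H) (S : Set H) : Submodule ℂ H :=
  Submodule.span ℂ {φ | ∃ x, ∃ ψ ∈ S, W x ψ = φ}

theorem subset_orbitSpan (W : MRep m H) {S : Set H} {ψ : H} (hψ : ψ ∈ S) :
    ψ ∈ W.orbitSpan S :=
  Submodule.subset_span ⟨0, ψ, hψ, W.map_zero ψ⟩

theorem isInvariant_orbitSpan (W : MRep m H) (S : Set H) : W.IsInvariant (W.orbitSpan S) := by
  intro x
  change W.orbitSpan S ≤ (W.orbitSpan S).comap (W x).toLinearEquiv.toLinearMap
  refine Submodule.span_le.mpr ?_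
  rintro _ ⟨y, ψ, hψ, rfl⟩
  change W x (W y ψ) ∈ W.orbitSpan S
  rw [W.map_mul]
  exact Submodule.smul_mem _ _ (Submodule.subset_span ⟨x + y, ψ, hψ, rfl⟩)

theorem IsInvariant.topologicalClosure {W : MRep m H} {K : Submodule ℂ H}
    (hK : W.IsInvariant K) : W.IsInvariant K.topologicalClosure :=
  fun x _ hψ => map_mem_closure (W x).continuous hψ fun φ hφ => hK x φ hφ

/-- Every vector lies in a finite-dimensional invariant subspace. -/
def IsLocallyFinite (W : MRep m H) : Prop :=
  ∀ ψ, FiniteDimensional ℂ (W.orbitSpan {ψ})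

/-- A nonzero finite-dimensional invariant subspace contains an irreducible one. -/
theorem IsInvariant.exists_isIrreducibleOn_le {W : MRep m H} {K : Submodule ℂ H}
    [FiniteDimensional ℂ K] (hK : W.IsInvariant K) (hne : K ≠ ⊥) :
    ∃ N ≤ K, W.IsIrreducibleOn N := by
  let S : Set (Submodule ℂ H) := {N | N ≤ K ∧ W.IsInvariant N ∧ N ≠ ⊥}
  obtain ⟨N, ⟨hNK, hN, hN0⟩, hmin⟩ :=
    (measure fun N : Submodule ℂ H => Module.finrank ℂ N).wf.has_min S ⟨K, le_rfl, hK, hne⟩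
  have : FiniteDimensional ℂ N := Submodule.finiteDimensional_of_le hNK
  refine ⟨N, hNK, N.closed_of_finiteDimensional, hN, hN0, fun M hMN _ hM => ?_⟩
  by_contra! h
  exact hmin M ⟨hMN.trans hNK, hM, h.1⟩
    (Submodule.finrank_lt_finrank_of_lt (lt_of_le_of_ne hMN h.2))

/-- A locally finite `m`-representation is a Hilbert sum of irreducible subspaces. -/
theorem IsLocallyFinite.exists_isHilbertSum [CompleteSpace H] {W : MRep m H}
    (hW : W.IsLocallyFinite) :
    ∃ 𝒦 : Set (Submodule ℂ H), (∀ K ∈ 𝒦, W.IsIrreducibleOn K) ∧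
      IsHilbertSum ℂ (fun K : 𝒦 => (K : Submodule ℂ H))
        (fun K => (K : Submodule ℂ H).subtypeₗᵢ) := by
  obtain ⟨𝒦, hmax⟩ := zorn_subset
    {𝒦 : Set (Submodule ℂ H) | (∀ K ∈ 𝒦, W.IsIrreducibleOn K) ∧ 𝒦.Pairwise (· ⟂ ·)} (by
      intro c hc hchain
      refine ⟨⋃₀ c, ⟨?_, ?_⟩, fun s hs => Set.subset_sUnion_of_mem hs⟩
      · rintro K ⟨s, hs, hK⟩
        exact (hc hs).1 K hK
      · exact (Set.pairwise_sUnion hchain.directedOn).mpr fun s hs => (hc hs).2)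
  have hirr := hmax.prop.1
  refine ⟨𝒦, hirr, ?_⟩
  have : ∀ K : 𝒦, CompleteSpace (K : Submodule ℂ H) := fun K =>
    (hirr K K.2).isClosed.completeSpace_coe
  refine IsHilbertSum.mkInternal _
    (OrthogonalFamily.of_pairwise fun K N hKN =>
      hmax.prop.2 K.2 N.2 (Subtype.coe_injective.ne hKN)) ?_
  rw [← sSup_eq_iSup', top_le_iff, Submodule.topologicalClosure_eq_top_iff]
  by_contra hne
  obtain ⟨ψ, hψ, hψ0⟩ := Submodule.exists_mem_ne_zero_of_ne_bot hne
  have hinv : W.IsInvariant (sSup 𝒦)ᗮ :=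
    (isInvariant_sSup fun K hK => (hirr K hK).invariant).orthogonal
  have hle : W.orbitSpan {ψ} ≤ (sSup 𝒦)ᗮ := by
    refine Submodule.span_le.mpr ?_
    rintro _ ⟨x, _, rfl, rfl⟩
    exact hinv x _ hψ
  have := hW ψ
  obtain ⟨N, hN, hNirr⟩ := (W.isInvariant_orbitSpan {ψ}).exists_isIrreducibleOn_le
    (fun h => hψ0 (by simpa [h] using W.subset_orbitSpan (Set.mem_singleton ψ)))
  have hort : ∀ K ∈ 𝒦, K ⟂ N := fun K hK =>
    (Submodule.isOrtho_orthogonal_right _).mono (le_sSup hK) (hN.trans hle)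
  -- By maximality `N` already belongs to the family, so it is orthogonal to itself.
  have hmem : N ∈ 𝒦 := by
    refine hmax.le_of_ge (y := insert N 𝒦) ⟨?_, ?_⟩ (Set.subset_insert _ _) (Set.mem_insert _ _)
    · rintro K (rfl | hK)
      exacts [hNirr, hirr K hK]
    · exact hmax.prop.2.insert fun K hK _ => ⟨(hort K hK).symm, hort K hK⟩
  exact hNirr.ne_bot (Submodule.isOrtho_self.mp (hort N hmem))

end Basic

/-! ### The vacuum space and transfer of irreducibility -/

variable {G : Type*} [AddCommGroup G] [TopologicalSpace G] [MeasurableSpace G]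
  {H : Type*} [NormedAddCommGroup H] [InnerProductSpace ℂ H] {m : Bicharacter G}

/-- The factor is `m x y / m y x = (m x y)²`; this square is why `L/2` and 2-regularity enter. -/
theorem commutation (W : MRep m H) (hm : m.IsAlternating) (x y : G) (ψ : H) :
    W x (W y ψ) = (m x (2 • y) : ℂ) • W y (W x ψ) := by
  rw [W.map_mul, W.map_mul, smul_smul, add_comm y x, hm.swap x y, two_nsmul, m.map_add_right,
    ← Circle.coe_mul, mul_inv_cancel_right]

/-- Outside `L/2`, the operators `W x` map the vacuum space into its orthogonal complement. -/
theorem inner_apply_eq_zero (W : MRep m H) (hm : m.IsAlternating) {L : AddSubgroup G}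
    (hL : m.IsMaximalIsotropic L) {x : G} (hx : x ∉ halfSubgroup L) {φ ψ : H}
    (hφ : φ ∈ W.vacuum L) (hψ : ψ ∈ W.vacuum L) : inner ℂ φ (W x ψ) = 0 := by
  have : ∃ a ∈ L, m a (2 • x) ≠ 1 := by
    by_contra! h
    exact hx (hL.mem_of_forall_eq_one hm h)
  obtain ⟨a, ha, hax⟩ := this
  have h : inner ℂ φ (W x ψ) = (m a (2 • x) : ℂ) * inner ℂ φ (W x ψ) := by
    conv_lhs => rw [← (W a).inner_map_map, hφ a ha, W.commutation hm, hψ a ha, inner_smul_right]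
  by_contra h0
  exact hax (Circle.ext (mul_right_cancel₀ h0 ((one_mul _).trans h)).symm)

/-- A nonzero closed invariant subspace contains a nonzero vacuum vector. -/
theorem IsInvariant.inf_vacuum_ne_bot [IsTopologicalAddGroup G] [T2Space G]
    [SecondCountableTopology G] [BorelSpace G] [CompleteSpace H] (hG : IsTwoRegular G)
    (hm : m.IsSymplectic) {L : AddSubgroup G} (hL : m.IsIsotropic L)
    (hLc : IsCompact (L : Set G)) {W : MRep m H} {K : Submodule ℂ H} (hK : W.IsInvariant K)
    (hKc : IsClosed (K : Set H)) (hne : K ≠ ⊥) : K ⊓ W.vacuum L ≠ ⊥ := by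
  intro hbot
  obtain ⟨ψ, hψ, hψ0⟩ := Submodule.exists_mem_ne_zero_of_ne_bot hne
  have : CompactSpace L := isCompact_iff_compactSpace.mp hLc
  have : SecondCountableTopology L := TopologicalSpace.Subtype.secondCountableTopology (L : Set G)
  let μ : Measure L := Measure.addHaar
  have hmeas : StronglyMeasurable fun a : L => W a ψ :=
    (W.borel ψ).comp_measurable measurable_subtype_coe
  have hint (z : G) : Integrable (fun a : L => m.restrictChar L z a • W a ψ) μ := by
    refine Integrable.of_bound (C := ‖ψ‖)
      ((m.restrictChar L z).continuous.stronglyMeasurable.smul hmeas).aestronglyMeasurable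
      (.of_forall fun a => ?_)
    rw [norm_smul, m.restrictChar_apply, Circle.norm_coe, one_mul, (W a).norm_map]
  have hzero (z : G) : ∫ a : L, m.restrictChar L z a • W a ψ ∂μ = 0 := by
    set φ := ∫ a : L, m.restrictChar L z a • W a ψ ∂μ with hφ
    have hφK : φ ∈ K := by
      have := hKc.completeSpace_coe
      -- `K` is closed, so it suffices to test the integral against `Kᗮ`.
      rw [← K.orthogonal_orthogonal]
      intro v hv
      rw [hφ, ← integral_inner (hint z)]
      refine integral_eq_zero_of_ae (.of_forall fun a => ?_)
      exact Submodule.inner_left_of_mem_orthogonal (K.smul_mem _ (hK a ψ hψ)) hv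
    have heig (b : L) : W b φ = (m b z : ℂ) • φ := by
      have h₁ : W b φ = ∫ a : L, W b (m.restrictChar L z a • W a ψ) ∂μ :=
        ((W b).toContinuousLinearEquiv.toContinuousLinearMap.integral_comp_comm (hint z)).symm
      have h₂ (a : L) : W b (m.restrictChar L z a • W a ψ) =
          (m b z : ℂ) • (m.restrictChar L z (b + a) • W (b + a : L) ψ) := by
        rw [_root_.map_smul, W.map_mul, hL b b.2 a a.2, Circle.coe_one, one_smul, smul_smul,
          m.restrictChar_apply, m.restrictChar_apply, hm.alternating.swap z b, ← Circle.coe_mul,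
          AddSubgroup.coe_add, m.map_add_right, inv_mul_cancel_left]
      simp_rw [h₁, h₂]
      rw [integral_smul, integral_add_left_eq_self (fun a : L => m.restrictChar L z a • W a ψ)]
    -- With `2y = -z`, commuting past `W y` cancels the eigencharacter `m · z` of `φ`.
    obtain ⟨y, hy⟩ := hG.2 (-z)
    have hvac : W y φ ∈ W.vacuum L := by
      intro a ha
      change 2 • y = -z at hy
      rw [W.commutation hm.alternating, hy, heig ⟨a, ha⟩, _root_.map_smul, smul_smul,
        m.map_neg_right, ← Circle.coe_mul, inv_mul_cancel, Circle.coe_one, one_smul]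
    have h : W y φ ∈ K ⊓ W.vacuum L := ⟨hK y φ hφK, hvac⟩
    rw [hbot, Submodule.mem_bot] at h
    exact (W y).map_eq_zero_iff.mp h
  have hae := ae_eq_zero_of_integral_smul_eq_zero_of_dense (μ := μ) hmeas (C := ‖ψ‖)
    (fun a => ((W a).norm_map ψ).le) (hm.dense_span_restrictChar L)
    (by rintro _ ⟨z, rfl⟩; exact hzero z)
  -- Haar measure on `L` is nonzero, so some `W a ψ` vanishes.
  obtain ⟨a, ha⟩ := hae.exists
  exact hψ0 ((W a).map_eq_zero_iff.mp ha)

theorem coe_vacuumRep_apply (W : MRep m H) (hm : m.IsAlternating) {L : AddSubgroup G}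
    (hL : m.IsIsotropic L) (x : halfSubgroup L) (ψ : W.vacuum L) :
    (W.vacuumRep hm hL x ψ : H) = W x ψ := rfl

theorem isLocallyFinite_vacuumRep [IsTopologicalAddGroup G] [T2Space G] [LocallyCompactSpace G]
    [SigmaCompactSpace G] (W : MRep m H) (hG : IsTwoRegular G)
    (hm : m.IsAlternating) {L : AddSubgroup G} (hL : m.IsMaximalIsotropic L)
    (hLc : IsCompact (L : Set G)) : (W.vacuumRep hm hL.prop).IsLocallyFinite := by
  intro ψ
  obtain ⟨s, hs, hcov⟩ := AddSubgroup.exists_finset_sub_mem_of_isCompact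
    (hL.isOpen_of_isCompact hm hLc) (isCompact_halfSubgroup hG hLc)
  let S : Set (W.vacuum L) := Set.range fun y : s => W.vacuumRep hm hL.prop ⟨y, hs y y.2⟩ ψ
  have hS : S.Finite := Set.finite_range _
  have := FiniteDimensional.span_of_finite ℂ hS
  refine Submodule.finiteDimensional_of_le (S₂ := Submodule.span ℂ S)
    (Submodule.span_le.mpr ?_)
  rintro _ ⟨x, _, rfl, rfl⟩
  obtain ⟨y, hy, hxy⟩ := hcov x x.2
  rename_i ψ
  have h : W.vacuumRep hm hL.prop x ψ =
      (m y (x - y) : ℂ)⁻¹ • W.vacuumRep hm hL.prop ⟨y, hs y hy⟩ ψ := by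
    refine Subtype.ext ?_
    rw [Submodule.coe_smul, coe_vacuumRep_apply, coe_vacuumRep_apply]
    conv_rhs => rw [← ψ.2 _ hxy, W.map_mul, add_sub_cancel, smul_smul,
      inv_mul_cancel₀ (Circle.coe_ne_zero _), one_smul]
  rw [h]
  exact Submodule.smul_mem _ _ (Submodule.subset_span ⟨⟨y, hy⟩, rfl⟩)

theorem IsLocallyFinite.finiteDimensional {G : Type*} [AddCommGroup G] [MeasurableSpace G]
    {m : G → G → Circle} {W : MRep m H} (hW : W.IsLocallyFinite) (hirr : W.IsIrreducible) :
    FiniteDimensional ℂ H := by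
  obtain ⟨ψ, -, hψ0⟩ := Submodule.exists_mem_ne_zero_of_ne_bot hirr.ne_bot
  have := hW ψ
  rcases hirr.eq_bot_or_eq (W.orbitSpan {ψ}) le_top (Submodule.closed_of_finiteDimensional _)
    (W.isInvariant_orbitSpan _) with h | h
  · exact absurd (by simpa [h] using W.subset_orbitSpan (Set.mem_singleton ψ)) hψ0
  · rw [h] at this
    exact Module.finite_def.mpr (Module.Finite.iff_fg.mp this)

/-- The closed `W`-span of an invariant `N ≤ H^L` is `0` or `H`. If it is `H`, a vacuum vector
orthogonal to `N` is orthogonal to all `W x N`: by invariance for `x ∈ L/2`, by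
`inner_apply_eq_zero` otherwise. Hence it is zero. -/
theorem IsIrreducible.vacuumRep [IsTopologicalAddGroup G] [T2Space G]
    [SecondCountableTopology G] [BorelSpace G] [CompleteSpace H] (hG : IsTwoRegular G)
    (hm : m.IsSymplectic) {L : AddSubgroup G} (hL : m.IsMaximalIsotropic L)
    (hLc : IsCompact (L : Set G)) {W : MRep m H} (hW : W.IsIrreducible) :
    (W.vacuumRep hm.alternating hL.prop).IsIrreducible where
  isClosed := isClosed_univ
  invariant _ _ _ := Submodule.mem_top
  ne_bot h := by
    refine hW.invariant.inf_vacuum_ne_bot hG hm hL.prop hLc hW.isClosed hW.ne_bot ?_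
    rw [top_inf_eq]
    exact Submodule.subsingleton_iff_eq_bot.mp ((Submodule.subsingleton_iff ℂ).mp
      (subsingleton_of_bot_eq_top h.symm))
  eq_bot_or_eq N _ hNc hN := by
    let S : Set H := Subtype.val '' (N : Set (W.vacuum L))
    rcases hW.eq_bot_or_eq (W.orbitSpan S).topologicalClosure le_top
      (Submodule.isClosed_topologicalClosure _) (W.isInvariant_orbitSpan S).topologicalClosure
      with h | h
    · left
      refine (Submodule.eq_bot_iff N).mpr fun ψ hψ => Subtype.ext ?_
      have : (ψ : H) ∈ (W.orbitSpan S).topologicalClosure :=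
        Submodule.le_topologicalClosure _ (W.subset_orbitSpan ⟨ψ, hψ, rfl⟩)
      rwa [h, Submodule.mem_bot] at this
    · right
      have := hNc.completeSpace_coe
      rw [← Submodule.orthogonal_eq_bot_iff]
      refine (Submodule.eq_bot_iff _).mpr fun φ hφ => Subtype.ext ?_
      rw [Submodule.topologicalClosure_eq_top_iff] at h
      rw [ZeroMemClass.coe_zero, ← Submodule.mem_bot ℂ, ← h]
      refine (Submodule.mem_orthogonal' _ _).mpr fun v hv => ?_
      induction hv using Submodule.span_induction with
      | mem v hv =>
        obtain ⟨x, _, ⟨ψ, hψ, rfl⟩, rfl⟩ := hv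
        by_cases hx : x ∈ halfSubgroup L
        · exact (Submodule.mem_orthogonal' N φ).mp hφ _ (hN ⟨x, hx⟩ ψ hψ)
        · exact W.inner_apply_eq_zero hm.alternating hL hx φ.2 ψ.2
      | zero => exact inner_zero_right _
      | add v w _ _ hv hw => rw [inner_add_right, hv, hw, add_zero]
      | smul c v _ hv => rw [inner_smul_right, hv, mul_zero]

/-- For closed invariant `K`, either `K ∩ H^L = 0`, or `H^L ≤ K` and `Kᗮ ∩ H^L = 0`; so `K` or `Kᗮ`
is zero. -/
theorem IsIrreducible.of_vacuumRep [IsTopologicalAddGroup G] [T2Space G]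
    [SecondCountableTopology G] [BorelSpace G] [CompleteSpace H] (hG : IsTwoRegular G)
    (hm : m.IsSymplectic) {L : AddSubgroup G} (hL : m.IsIsotropic L)
    (hLc : IsCompact (L : Set G)) {W : MRep m H}
    (hW : (W.vacuumRep hm.alternating hL).IsIrreducible) : W.IsIrreducible where
  isClosed := isClosed_univ
  invariant _ _ _ := Submodule.mem_top
  ne_bot h := by
    refine hW.ne_bot (((Submodule.eq_bot_iff _).mpr fun ψ _ => Subtype.ext ?_))
    exact (Submodule.mem_bot ℂ).mp (h ▸ Submodule.mem_top)
  eq_bot_or_eq K _ hKc hK := by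
    rcases hW.eq_bot_or_eq (K.comap (W.vacuum L).subtype) le_top
      (hKc.preimage continuous_subtype_val) (fun x ψ hψ => hK x ψ hψ) with h | h
    · left
      by_contra hne
      refine hK.inf_vacuum_ne_bot hG hm hL hLc hKc hne
        ((Submodule.eq_bot_iff _).mpr fun ψ hψ => ?_)
      have hmem : (⟨ψ, hψ.2⟩ : W.vacuum L) ∈ K.comap (W.vacuum L).subtype := hψ.1
      rw [h, Submodule.mem_bot] at hmem
      exact congrArg Subtype.val hmem
    · right
      have := hKc.completeSpace_coe
      rw [← Submodule.orthogonal_eq_bot_iff]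
      by_contra hne
      refine hK.orthogonal.inf_vacuum_ne_bot hG hm hL hLc K.isClosed_orthogonal hne
        ((Submodule.eq_bot_iff _).mpr fun ψ hψ => ?_)
      have hmem : (⟨ψ, hψ.2⟩ : W.vacuum L) ∈ K.comap (W.vacuum L).subtype :=
        h ▸ Submodule.mem_top
      exact inner_self_eq_zero.mp (hψ.1 ψ hmem)

end MRep

end

theorem lemma4p4 {G : Type*} [AddCommGroup G] [TopologicalSpace G] [IsTopologicalAddGroup G]
    [T2Space G] [LocallyCompactSpace G] [SecondCountableTopology G]
    [MeasurableSpace G] [BorelSpace G]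
    (hG : IsTwoRegular G)
    (m : Bicharacter G) (hm : m.IsSymplectic)
    (L : AddSubgroup G) (hL : m.IsMaximalIsotropic L) (hLc : IsCompact (L : Set G))
    {H : Type*} [NormedAddCommGroup H] [InnerProductSpace ℂ H] [CompleteSpace H]
    (W : MRep m H) :
    (∃ 𝒦 : Set (Submodule ℂ (W.vacuum L)),
      (∀ K ∈ 𝒦, (W.vacuumRep hm.alternating hL.prop).IsIrreducibleOn K) ∧
      IsHilbertSum ℂ (fun K : 𝒦 => (K : Submodule ℂ (W.vacuum L)))
        (fun K => (K : Submodule ℂ (W.vacuum L)).subtypeₗᵢ)) ∧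
    (W.IsIrreducible ↔ (W.vacuumRep hm.alternating hL.prop).IsIrreducible) ∧
    (W.IsIrreducible → FiniteDimensional ℂ (W.vacuum L)) := by
  have hfin := W.isLocallyFinite_vacuumRep hG hm.alternating hL hLc
  have hirr : W.IsIrreducible → (W.vacuumRep hm.alternating hL.prop).IsIrreducible :=
    fun hW => hW.vacuumRep hG hm hL hLc
  exact ⟨hfin.exists_isHilbertSum,
    ⟨hirr, fun hW => hW.of_vacuumRep hG hm hL.prop hLc⟩,
    fun hW => hfin.finiteDimensional (hirr hW)⟩
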